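/- Let $n\in\mathbb N$ and let $\mathcal H$ be a complex Hilbert space of arbitrary (finite or infinite) dimension, with algebra $\mathcal B(\mathcal H)$ of bounded linear operators. Let $C(S^1)_{(n)}$ be the space of all continuous functions $f:S^1\to\mathbb C$ on the unit circle whose Fourier coefficients $\hat f(k)=\frac1{2\pi}\int_0^{2\pi}f(e^{i\theta})e^{-ik\theta}\,d\theta$ vanish for every integer $k$ with $|k|\ge n$. Each element $F$ of the tensor product $C(S^1)_{(n)}\otimes\mathcal B(\mathcal H)$ is identified with the continuous function $$F(z)=\sum_{\ell=-n+1}^{n-1}z^\ell\,\tau_\ell\qquad(z\in S^1,\ \tau_\ell\in\mathcal B(\mathcal H)),$$ an elementary tensor $f\otimes\tau$ being the function $z\mapsto f(z)\tau$. Let $\left(C(S^1)_{(n)}\otimes\mathcal B(\mathcal H)\right)_+$ be the convex cone of those $F$ for which $F(z)$ is a positive operator for every $z\in S^1$. An element $F$ of this cone is called pure if, whenever $F=G_1+G_2$ with $G_1,G_2$ in the cone, there is a scalar $s\in[0,1]$ such that $G_1=sF$ and $G_2=(1-s)F$. For $z\in S^1$ let $T_n(z)=[z^{\,i-j}]_{i,j=0}^{n-1}$,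 an $n\times n$ complex Toeplitz matrix, viewed as an operator on the Hilbert space $\mathbb C^n$. If $F\in\left(C(S^1)_{(n)}\otimes\mathcal B(\mathcal H)\right)_+$ is pure, then there exists a bounded linear operator $w:\mathcal H\to\mathbb C^n$ such that $$F(z)=w^*\,T_n(z^{-1})\,w\qquad\text{for every } z\in S^1 .$$ -/

import Mathlib

open scoped TensorProduct

namespace TrigSystem

/-- The `k`-th Fourier coefficient of a continuous function on the unit circle,
`(1 / 2π) ∫₀^{2π} f(e^{iθ}) e^{-ikθ} dθ`. -/
noncomputable def fourierCoefficient (f : C(Circle, ℂ)) (k : ℤ) : ℂ :=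
  (1 / (2 * (Real.pi : ℂ))) *
    ∫ θ in (0 : ℝ)..(2 * Real.pi), f (Circle.exp θ) * Complex.exp (-(Complex.I * k * θ))

theorem intervalIntegrable_aux (f : C(Circle, ℂ)) (k : ℤ) :
    IntervalIntegrable
      (fun θ : ℝ => f (Circle.exp θ) * Complex.exp (-(Complex.I * k * θ)))
      MeasureTheory.volume 0 (2 * Real.pi) := by
  apply Continuous.intervalIntegrable
  have h : Continuous fun θ : ℝ => f (Circle.exp θ) := f.continuous.comp Circle.exp.continuous
  fun_prop

/-- The space `C(S¹)_(n)` of continuous functions on the unit circle whose Fourier coefficients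
vanish at every integer `k` with `|k| ≥ n`. -/
noncomputable def trigPoly (n : ℕ) : Submodule ℂ C(Circle, ℂ) where
  carrier := {f | ∀ k : ℤ, (n : ℤ) ≤ |k| → fourierCoefficient f k = 0}
  zero_mem' := by
    intro k _
    simp [fourierCoefficient]
  add_mem' := by
    intro f g hf hg k hk
    have h : fourierCoefficient (f + g) k = fourierCoefficient f k + fourierCoefficient g k := by
      simp only [fourierCoefficient, ContinuousMap.add_apply, add_mul]
      rw [intervalIntegral.integral_add (intervalIntegrable_aux f k)
        (intervalIntegrable_aux g k), mul_add]
    rw [h, hf k hk, hg k hk, add_zero]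
  smul_mem' := by
    intro c f hf k hk
    have h : fourierCoefficient (c • f) k = c * fourierCoefficient f k := by
      simp only [fourierCoefficient, ContinuousMap.smul_apply, smul_eq_mul, mul_assoc c]
      rw [intervalIntegral.integral_const_mul, mul_left_comm]
    rw [h, hf k hk, mul_zero]

variable (H : Type*) [NormedAddCommGroup H] [InnerProductSpace ℂ H]

/-- The function form of an element of `C(S¹)_(n) ⊗ B(H)`: the elementary tensor `f ⊗ τ` is the
continuous `B(H)`-valued function `z ↦ f(z) τ`, so that `∑ χ_ℓ ⊗ τ_ℓ` is `z ↦ ∑ z^ℓ τ_ℓ`. -/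
noncomputable def functionForm (n : ℕ) :
    (trigPoly n ⊗[ℂ] (H →L[ℂ] H)) →ₗ[ℂ] C(Circle, H →L[ℂ] H) :=
  TensorProduct.lift <| LinearMap.mk₂ ℂ
    (fun (f : trigPoly n) (τ : H →L[ℂ] H) =>
      (⟨fun z => (f : C(Circle, ℂ)) z • τ, by fun_prop⟩ : C(Circle, H →L[ℂ] H)))
    (fun f g τ => by ext z x; simp [add_smul])
    (fun c f τ => by ext z x; simp [mul_smul])
    (fun f τ σ => by ext z x; simp)
    (fun c f τ => by ext z x; exact congrArg (fun A : H →L[ℂ] H => A x) (smul_comm _ c τ))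

variable {H} in
@[simp] theorem functionForm_tmul_apply (n : ℕ) (f : trigPoly n) (τ : H →L[ℂ] H) (z : Circle) :
    functionForm H n (f ⊗ₜ[ℂ] τ) z = (f : C(Circle, ℂ)) z • τ := rfl

/-- The positive cone of `C(S¹)_(n) ⊗_min B(H)`, whose order is the one inherited from
`C(S¹) ⊗_min B(H) = C(S¹, B(H))`: an element is positive when its function form takes
positive operators as values at all points of the circle. -/
noncomputable def positiveCone (n : ℕ) : ConvexCone ℝ (trigPoly n ⊗[ℂ] (H →L[ℂ] H)) where
  carrier := {F | ∀ z : Circle, (functionForm H n F z).IsPositive}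
  smul_mem' := by
    intro c hc F hF z
    have h : functionForm H n (c • F) z = (c : ℂ) • functionForm H n F z := by
      rw [show c • F = (c : ℂ) • F from (algebraMap_smul ℂ c F).symm, map_smul]
      rfl
    rw [h]
    exact (hF z).smul_of_nonneg (by exact_mod_cast hc.le)
  add_mem' := by
    intro F hF G hG z
    rw [map_add]
    exact (hF z).add (hG z)

/-- An element `φ` of a convex cone `C` is pure if `ϑ + ω = φ` with `ϑ, ω ∈ C` forces
`ϑ = s φ` and `ω = (1 - s) φ` for some `s ∈ [0, 1]`. -/
def IsPure {E : Type*} [AddCommMonoid E] [Module ℝ E] (C : ConvexCone ℝ E) (φ : E) : Prop :=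
  φ ∈ C ∧ ∀ ϑ ∈ C, ∀ ω ∈ C, ϑ + ω = φ →
    ∃ s ∈ Set.Icc (0 : ℝ) 1, ϑ = s • φ ∧ ω = (1 - s) • φ

/-- The universal positive Toeplitz matrix `T_n(z) = [z^(i-j)]`. -/
noncomputable def universalToeplitz (n : ℕ) (z : Circle) : Matrix (Fin n) (Fin n) ℂ :=
  Matrix.of fun i j => (z : ℂ) ^ ((i : ℤ) - (j : ℤ))

end TrigSystem

/-! A nonzero positive `F` dominates a nonzero function of the form `w* T_n(z⁻¹) w`. Purity makes
that function `s F` with `s ≠ 0`, and rescaling `w` gives the claim. The minorant comes from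
operator-valued Fejér–Riesz (`exists_norm_sq_sum_eq`): `⟪h, F(z) h⟫ = ‖∑ z^j w_j h‖²` with `w_j`
valued in a Hilbert space `E`. Pairing the `w_j` with a unit vector of `E` only decreases the norm
and leaves scalar functionals (`exists_norm_sq_sum_le`). For the factorization, `F` defines a
semi-inner product on `C(S¹, H)` for which multiplication by `z⁻¹` is isometric. With `S k` the
closed span of the `z^(-j) h`, `j ≥ k`, the `w_j` are the parts of these monomials in the layer `S d
⊖ S (d + 1)`, where `n = d + 1`. Pythagoras and shift invariance of distances recover `F`. -/

namespace TrigSystem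

/-! ### Finite Fourier expansions. -/

theorem fourierCoeff_comp_toCircle [Fact (0 < 2 * Real.pi)] (f : C(Circle, ℂ)) (k : ℤ) :
    fourierCoeff (fun t : AddCircle (2 * Real.pi) => f (AddCircle.toCircle t)) k =
      fourierCoefficient f k := by
  rw [fourierCoeff_eq_intervalIntegral _ _ 0, fourierCoefficient, zero_add, Complex.real_smul]
  push_cast
  congr 1
  refine intervalIntegral.integral_congr fun θ _ => ?_
  have h2 : (2 * Real.pi / (2 * Real.pi) : ℝ) = 1 := div_self Real.two_pi_pos.ne'
  simp only [fourier_coe_apply, AddCircle.toCircle_apply_mk, h2, one_mul, smul_eq_mul]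
  rw [mul_comm]
  congr 2
  have : (Real.pi : ℂ) ≠ 0 := by exact_mod_cast Real.pi_ne_zero
  push_cast
  field_simp

/-- Members of `trigPoly n` are given by their finite Fourier expansion. -/
theorem trigPoly_apply_eq_sum {n : ℕ} {f : C(Circle, ℂ)} (hf : f ∈ trigPoly n) (z : Circle) :
    f z = ∑ k ∈ Finset.Ioo (-(n : ℤ)) n, fourierCoefficient f k * (z : ℂ) ^ k := by
  have : Fact (0 < 2 * Real.pi) := ⟨Real.two_pi_pos⟩
  let g : C(AddCircle (2 * Real.pi), ℂ) :=
    ⟨fun t => f (AddCircle.toCircle t), f.continuous.comp AddCircle.continuous_toCircle⟩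
  have hg : ∀ k, fourierCoeff g k = fourierCoefficient f k := fourierCoeff_comp_toCircle f
  have hz : ∀ k ∉ Finset.Ioo (-(n : ℤ)) n, fourierCoeff g k = 0 := fun k hk => by
    rw [hg]
    refine hf k ?_
    by_contra! h
    exact hk (Finset.mem_Ioo.2 (abs_lt.1 h))
  obtain ⟨t, rfl⟩ := (AddCircle.homeomorphCircle (T := 2 * Real.pi)
    Real.two_pi_pos.ne').surjective z
  rw [AddCircle.homeomorphCircle_apply]
  have h1 := has_pointwise_sum_fourier_series_of_summable (f := g)
    (summable_of_ne_finset_zero hz) t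
  have h2 := h1.unique (hasSum_sum_of_ne_finset_zero (s := Finset.Ioo (-(n : ℤ)) n) fun k hk => by
    rw [hz k hk, zero_smul])
  refine h2.trans (Finset.sum_congr rfl fun k _ => ?_)
  rw [hg, smul_eq_mul, fourier_apply, AddCircle.toCircle_zsmul, Circle.coe_zpow]

/-- The character `z ↦ z ^ k` of the circle. -/
noncomputable def character (k : ℤ) : C(Circle, ℂ) :=
  ⟨fun z => ((z ^ k : Circle) : ℂ), continuous_subtype_val.comp (continuous_zpow k)⟩

@[simp] theorem character_apply (k : ℤ) (z : Circle) : character k z = (z : ℂ) ^ k := by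
  simp [character]

theorem character_mem_trigPoly {n : ℕ} {k : ℤ} (hk : |k| < n) : character k ∈ trigPoly n := by
  intro m hm
  have : Fact (0 < 2 * Real.pi) := ⟨Real.two_pi_pos⟩
  rw [← fourierCoeff_comp_toCircle]
  have : (fun t : AddCircle (2 * Real.pi) => character k (AddCircle.toCircle t)) =
      fourier (T := 2 * Real.pi) k := by
    ext t
    rw [character_apply, fourier_apply, AddCircle.toCircle_zsmul, Circle.coe_zpow]
  rw [this, fourierCoeff_fourier, Pi.single_eq_of_ne]
  rintro rfl
  omega

/-- The matrix coefficients of an element of the cone are trigonometric polynomials. -/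
theorem inner_functionForm_mem_trigPoly {H : Type*} [NormedAddCommGroup H] [InnerProductSpace ℂ H]
    (n : ℕ) (F : trigPoly n ⊗[ℂ] (H →L[ℂ] H)) (a b : H) :
    (⟨fun z => inner ℂ a (functionForm H n F z b), by fun_prop⟩ : C(Circle, ℂ)) ∈ trigPoly n := by
  induction F using TensorProduct.induction_on with
  | zero =>
    convert (trigPoly n).zero_mem using 1
    ext z; simp
  | tmul f τ =>
    convert (trigPoly n).smul_mem (inner ℂ a (τ b)) f.2 using 1
    ext z; simp [mul_comm]
  | add F G hF hG =>
    convert (trigPoly n).add_mem hF hG using 1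
    ext z; simp

end TrigSystem

-- Hilbert-space preliminaries.

universe u

/-- A semi-inner product factors through a Hilbert space. -/
theorem PreInnerProductSpace.Core.exists_hilbert {L : Type u} [AddCommGroup L] [Module ℂ L]
    (c : PreInnerProductSpace.Core ℂ L) :
    ∃ (E : Type u) (_ : NormedAddCommGroup E) (_ : InnerProductSpace ℂ E) (_ : CompleteSpace E)
      (ι : L →ₗ[ℂ] E), ∀ x y, inner ℂ (ι x) (ι y) = c.inner x y := by
  let _ : SeminormedAddCommGroup L := InnerProductSpace.Core.toSeminormedAddCommGroup (c := c)
  let _ : InnerProductSpace ℂ L := InnerProductSpace.ofCore c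
  refine ⟨UniformSpace.Completion L, inferInstance, inferInstance, inferInstance,
    (UniformSpace.Completion.toComplL (𝕜 := ℂ) (E := L)).toLinearMap, fun x y => ?_⟩
  exact UniformSpace.Completion.inner_coe x y

section Projection

variable {E : Type*} [NormedAddCommGroup E] [InnerProductSpace ℂ E]

/-- Distances to the span itself can be transported by the shift on functions, so the shift need not
be extended to `E`. -/
theorem norm_sub_starProjection_closure_eq_infDist [CompleteSpace E] (T : Submodule ℂ E) (v : E) :
    ‖v - T.topologicalClosure.starProjection v‖ = Metric.infDist v (T : Set E) := by
  rw [Submodule.starProjection_minimal, ← Metric.infDist_closure, Metric.infDist_eq_iInf,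
    ← Submodule.topologicalClosure_coe]
  simp only [dist_eq_norm]
  rfl

/-- Pythagoras for the distances of a vector to two nested closed subspaces. -/
theorem norm_sq_starProjection_sub_starProjection {S T : Submodule ℂ E}
    [S.HasOrthogonalProjection] [T.HasOrthogonalProjection] (h : T ≤ S) (v : E) :
    ‖S.starProjection v - T.starProjection v‖ ^ 2 =
      ‖v - T.starProjection v‖ ^ 2 - ‖v - S.starProjection v‖ ^ 2 := by
  have h1 : inner ℂ (v - S.starProjection v) (S.starProjection v - T.starProjection v) = 0 :=
    S.starProjection_inner_eq_zero _ _
      (S.sub_mem (S.starProjection_apply_mem _) (h (T.starProjection_apply_mem _)))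
  have h2 := norm_add_sq_eq_norm_sq_add_norm_sq_of_inner_eq_zero _ _ h1
  rw [sub_add_sub_cancel] at h2
  nlinarith

end Projection

/-! ### The semi-inner product on `C(S¹, H)`, the shift and its tails. -/

namespace TrigSystem

theorem fourierCoefficient_add (f g : C(Circle, ℂ)) (k : ℤ) :
    fourierCoefficient (f + g) k = fourierCoefficient f k + fourierCoefficient g k := by
  simp only [fourierCoefficient, ContinuousMap.add_apply, add_mul]
  rw [intervalIntegral.integral_add (intervalIntegrable_aux f k) (intervalIntegrable_aux g k),
    mul_add]

theorem fourierCoefficient_smul (c : ℂ) (f : C(Circle, ℂ)) (k : ℤ) :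
    fourierCoefficient (c • f) k = c * fourierCoefficient f k := by
  simp only [fourierCoefficient, ContinuousMap.smul_apply, smul_eq_mul, mul_assoc c]
  rw [intervalIntegral.integral_const_mul, mul_left_comm]

theorem norm_fourierCoefficient_le (f : C(Circle, ℂ)) (k : ℤ) : ‖fourierCoefficient f k‖ ≤ ‖f‖ := by
  have h := intervalIntegral.norm_integral_le_of_norm_le_const (a := 0) (b := 2 * Real.pi)
    (f := fun θ : ℝ => f (Circle.exp θ) * Complex.exp (-(Complex.I * k * θ))) (C := ‖f‖)
    fun θ _ => by
      have : ‖Complex.exp (-(Complex.I * k * θ))‖ = 1 := by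
        rw [Complex.norm_exp]; simp
      rw [norm_mul, this, mul_one]
      exact f.norm_coe_le_norm _
  have hpi := Real.two_pi_pos
  rw [sub_zero, abs_of_pos hpi] at h
  have hn : ‖(1 / (2 * (Real.pi : ℂ)))‖ = 1 / (2 * Real.pi) := by
    rw [norm_div, norm_one, norm_mul, Complex.norm_real, Complex.norm_ofNat,
      Real.norm_of_nonneg Real.pi_pos.le]
  rw [fourierCoefficient, norm_mul, hn, div_mul_eq_mul_div, one_mul, div_le_iff₀ hpi]
  exact h

theorem conj_fourierCoefficient (f : C(Circle, ℂ)) (k : ℤ) :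
    (starRingEnd ℂ) (fourierCoefficient f k) = fourierCoefficient (star f) (-k) := by
  rw [fourierCoefficient, fourierCoefficient, map_mul, ← intervalIntegral.intervalIntegral_conj]
  congr 1
  · simp [Complex.conj_ofNat]
  · refine intervalIntegral.integral_congr fun θ _ => ?_
    simp [← Complex.exp_conj]

theorem re_fourierCoefficient_zero_nonneg {f : C(Circle, ℂ)} (hf : ∀ z, 0 ≤ (f z).re) :
    0 ≤ (fourierCoefficient f 0).re := by
  have h : 0 ≤ (∫ θ in (0 : ℝ)..(2 * Real.pi), f (Circle.exp θ)).re := by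
    rw [← Complex.reCLM_apply, ← ContinuousLinearMap.intervalIntegral_comp_comm]
    · exact intervalIntegral.integral_nonneg Real.two_pi_pos.le fun θ _ => hf _
    · exact (f.continuous.comp Circle.exp.continuous).intervalIntegrable _ _
  have hc : (1 / (2 * (Real.pi : ℂ))) = ((1 / (2 * Real.pi) : ℝ) : ℂ) := by push_cast; rfl
  rw [fourierCoefficient, hc, Complex.re_ofReal_mul]
  refine mul_nonneg (by positivity) ?_
  simpa using h

theorem fourierCoefficient_character_mul (f : C(Circle, ℂ)) (j k : ℤ) :
    fourierCoefficient (character j * f) k = fourierCoefficient f (k - j) := by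
  rw [fourierCoefficient, fourierCoefficient]
  congr 1
  refine intervalIntegral.integral_congr fun θ _ => ?_
  simp only [ContinuousMap.mul_apply, character_apply, Circle.coe_exp, ← Complex.exp_int_mul]
  rw [mul_comm (Complex.exp _) (f _), mul_assoc, ← Complex.exp_add]
  congr 2
  push_cast
  ring

variable {H : Type*} [NormedAddCommGroup H] [InnerProductSpace ℂ H]

/-- The function `z ↦ ⟪x z, Φ z (y z)⟫`. -/
noncomputable def pairing (Φ : C(Circle, H →L[ℂ] H)) (x y : C(Circle, H)) : C(Circle, ℂ) :=
  ⟨fun z => inner ℂ (x z) (Φ z (y z)), by fun_prop⟩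

@[simp] theorem pairing_apply (Φ : C(Circle, H →L[ℂ] H)) (x y : C(Circle, H)) (z : Circle) :
    pairing Φ x y z = inner ℂ (x z) (Φ z (y z)) := rfl

/-- The semi-inner product `∫ ⟪x z, Φ z (y z)⟫` defined by a positive operator function. -/
noncomputable abbrev pairingCore (Φ : C(Circle, H →L[ℂ] H)) (hΦ : ∀ z, (Φ z).IsPositive) :
    PreInnerProductSpace.Core ℂ C(Circle, H) where
  inner x y := fourierCoefficient (pairing Φ x y) 0
  conj_inner_symm x y := by
    rw [conj_fourierCoefficient, neg_zero]
    congr 1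
    ext z
    simp only [ContinuousMap.star_apply, pairing_apply, RCLike.star_def, inner_conj_symm]
    exact (hΦ z).isSymmetric _ _
  re_inner_nonneg x := re_fourierCoefficient_zero_nonneg fun z => (hΦ z).re_inner_nonneg_right (x z)
  add_left x y v := by
    rw [← fourierCoefficient_add]
    congr 1
    ext z
    simp
  smul_left x y c := by
    rw [← fourierCoefficient_smul]
    congr 1
    ext z
    simp [mul_comm]

/-- The function `z ↦ z ^ (-j) h`. -/
noncomputable def monomial (j : ℕ) : H →ₗ[ℂ] C(Circle, H) where
  toFun h := ⟨fun z => character (-j) z • h, by fun_prop⟩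
  map_add' a b := by ext z; simp
  map_smul' c a := by ext z; exact smul_comm _ c a

theorem monomial_apply (j : ℕ) (h : H) (z : Circle) :
    monomial j h z = character (-j) z • h := rfl

/-- Multiplication of a function on the circle by `z⁻¹`. -/
noncomputable def shift : C(Circle, H) →ₗ[ℂ] C(Circle, H) where
  toFun x := ⟨fun z => character (-1) z • x z, by fun_prop⟩
  map_add' a b := by ext z; simp
  map_smul' c a := by ext z; exact smul_comm _ c (a z)

theorem shift_apply (x : C(Circle, H)) (z : Circle) : shift x z = character (-1) z • x z := rfl

theorem shift_monomial (j : ℕ) (h : H) : shift (monomial j h) = monomial (j + 1) h := by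
  ext z
  rw [shift_apply, monomial_apply, monomial_apply, smul_smul]
  simp only [character_apply]
  rw [← zpow_add₀ (Circle.coe_ne_zero z)]
  congr 2
  push_cast
  ring

theorem pairing_shift (Φ : C(Circle, H →L[ℂ] H)) (x y : C(Circle, H)) :
    pairing Φ (shift x) (shift y) = pairing Φ x y := by
  ext z
  simp only [pairing_apply, shift_apply, map_smul, inner_smul_left, inner_smul_right,
    character_apply, ← mul_assoc]
  simp [← Circle.coe_inv_eq_conj]

/-- The Gram matrix of the monomials is block Toeplitz: it depends on `j - i` only. -/
theorem fourierCoefficient_pairing_monomial (Φ : C(Circle, H →L[ℂ] H)) (i j : ℕ) (a b : H) :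
    fourierCoefficient (pairing Φ (monomial i a) (monomial j b)) 0 =
      fourierCoefficient (pairing Φ (.const _ a) (.const _ b)) (j - i) := by
  have : pairing Φ (monomial i a) (monomial j b) =
      character (i - j) * pairing Φ (.const _ a) (.const _ b) := by
    ext z
    simp only [pairing_apply, monomial_apply, map_smul, inner_smul_left, inner_smul_right,
      character_apply, ContinuousMap.mul_apply, ContinuousMap.const_apply]
    rw [← mul_assoc, sub_eq_neg_add, zpow_add₀ (Circle.coe_ne_zero z)]
    simp [← Circle.coe_inv_eq_conj]
  rw [this, fourierCoefficient_character_mul]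
  congr 1
  ring

/-- The span of the monomials `z ^ (-j) h` with `k ≤ j`. -/
noncomputable def tail (H : Type*) [NormedAddCommGroup H] [InnerProductSpace ℂ H] (k : ℕ) :
    Submodule ℂ C(Circle, H) :=
  Submodule.span ℂ {x | ∃ j, k ≤ j ∧ ∃ h : H, monomial j h = x}

theorem tail_succ_le (k : ℕ) : tail H (k + 1) ≤ tail H k :=
  Submodule.span_mono fun _ ⟨j, hj, h⟩ => ⟨j, by omega, h⟩

theorem tail_succ_eq_map (k : ℕ) : tail H (k + 1) = (tail H k).map shift := by
  rw [tail, tail, Submodule.map_span]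
  congr 1
  ext x
  constructor
  · rintro ⟨j, hj, h, rfl⟩
    obtain ⟨i, rfl⟩ := Nat.exists_eq_add_of_le' (show 1 ≤ j by omega)
    exact ⟨_, ⟨i, by omega, h, rfl⟩, shift_monomial i h⟩
  · rintro ⟨_, ⟨i, hi, h, rfl⟩, rfl⟩
    exact ⟨i + 1, by omega, h, (shift_monomial i h).symm⟩

end TrigSystem

theorem Finset.sum_Ioo_neg_succ {M : Type*} [AddCommMonoid M] (g : ℤ → M) (d : ℕ) :
    ∑ k ∈ Finset.Ioo (-((d + 1 : ℕ) : ℤ)) ((d + 1 : ℕ) : ℤ), g k =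
      g 0 + ∑ j ∈ Finset.range d, (g (j + 1) + g (-(j + 1))) := by
  induction d with
  | zero =>
    have : Finset.Ioo (-((0 + 1 : ℕ) : ℤ)) ((0 + 1 : ℕ) : ℤ) = {0} := by
      ext k; simp only [Finset.mem_Ioo, Finset.mem_singleton]; omega
    rw [this]; simp
  | succ d ih =>
    have : Finset.Ioo (-((d + 1 + 1 : ℕ) : ℤ)) ((d + 1 + 1 : ℕ) : ℤ) =
        insert ((d : ℤ) + 1) (insert (-((d : ℤ) + 1))
          (Finset.Ioo (-((d + 1 : ℕ) : ℤ)) ((d + 1 : ℕ) : ℤ))) := by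
      ext k; simp only [Finset.mem_Ioo, Finset.mem_insert]; omega
    rw [this, Finset.sum_insert, Finset.sum_insert, ih, Finset.sum_range_succ]
    · abel
    · simp only [Finset.mem_Ioo]; omega
    · simp only [Finset.mem_Ioo, Finset.mem_insert]; omega

theorem Metric.infDist_image_of_dist_eq {X Y Z : Type*} [PseudoMetricSpace Y] [PseudoMetricSpace Z]
    {f : X → Y} {g : X → Z} (h : ∀ x y, dist (g x) (g y) = dist (f x) (f y)) (x : X) (A : Set X) :
    Metric.infDist (g x) (g '' A) = Metric.infDist (f x) (f '' A) := by
  have h' : ∀ x y, edist (g x) (g y) = edist (f x) (f y) := fun x y => by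
    rw [edist_dist, edist_dist, h]
  simp only [Metric.infDist, Metric.infEDist, iInf_image, h']

/-! ### Operator-valued Fejér–Riesz factorization. -/

namespace TrigSystem

variable {H : Type u} [NormedAddCommGroup H] [InnerProductSpace ℂ H]

/-- The degree bound enters here: constants are orthogonal to all monomials of index at least `n`.
-/
theorem fourierCoefficient_pairing_monomial_tail {Φ : C(Circle, H →L[ℂ] H)} {n : ℕ}
    (hn : ∀ a b : H, pairing Φ (.const _ a) (.const _ b) ∈ trigPoly n) (a : H)
    {x : C(Circle, H)} (hx : x ∈ tail H n) :
    fourierCoefficient (pairing Φ (monomial 0 a) x) 0 = 0 := by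
  induction hx using Submodule.span_induction with
  | mem x hx =>
    obtain ⟨j, hj, b, rfl⟩ := hx
    rw [fourierCoefficient_pairing_monomial]
    exact hn a b _ (by simpa using hj)
  | zero =>
    have : pairing Φ (monomial 0 a) 0 = 0 := by ext z; simp
    -- Membership in `trigPoly 0` means that every Fourier coefficient vanishes.
    rw [this]; exact (trigPoly 0).zero_mem 0 (by simp)
  | add x y _ _ hx hy =>
    have : pairing Φ (monomial 0 a) (x + y) =
      pairing Φ (monomial 0 a) x + pairing Φ (monomial 0 a) y := by ext z; simp
    rw [this, fourierCoefficient_add, hx, hy, add_zero]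
  | smul c x _ hx =>
    have : pairing Φ (monomial 0 a) (c • x) = c • pairing Φ (monomial 0 a) x := by
      ext z; simp
    rw [this, fourierCoefficient_smul, hx, mul_zero]

theorem re_inner_apply_eq_fourier_sum {Φ : C(Circle, H →L[ℂ] H)} (hΦ : ∀ z, (Φ z).IsPositive)
    {d : ℕ} (h : H) (hn : pairing Φ (.const _ h) (.const _ h) ∈ trigPoly (d + 1)) (z : Circle) :
    (inner ℂ h (Φ z h)).re = (fourierCoefficient (pairing Φ (.const _ h) (.const _ h)) 0).re +
      2 * (∑ j ∈ Finset.range d,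
        fourierCoefficient (pairing Φ (.const _ h) (.const _ h)) (j + 1) * (z : ℂ) ^ (j + 1)).re := by
  set φ := pairing Φ (.const _ h) (.const _ h) with hφ
  have hstar : star φ = φ := by
    ext z
    simp only [ContinuousMap.star_apply, hφ, pairing_apply, RCLike.star_def, inner_conj_symm]
    exact (hΦ z).isSymmetric _ _
  have h1 : inner ℂ h (Φ z h) = φ z := rfl
  rw [h1, trigPoly_apply_eq_sum hn, Finset.sum_Ioo_neg_succ, Complex.add_re, zpow_zero, mul_one,
    Complex.re_sum, Complex.re_sum, Finset.mul_sum]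
  congr 1
  refine Finset.sum_congr rfl fun j _ => ?_
  have h2 : fourierCoefficient φ (-(j + 1)) * (z : ℂ) ^ (-((j : ℤ) + 1)) =
      (starRingEnd ℂ) (fourierCoefficient φ (j + 1) * (z : ℂ) ^ (j + 1)) := by
    rw [map_mul, conj_fourierCoefficient, hstar, map_pow, ← Circle.coe_inv_eq_conj, Circle.coe_inv,
      zpow_neg, inv_pow]
    norm_cast
  have h3 : (z : ℂ) ^ ((j : ℤ) + 1) = (z : ℂ) ^ (j + 1) := by norm_cast
  rw [h2, h3, Complex.add_re, Complex.conj_re, two_mul]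

/-- Fejér–Riesz factorization of a positive operator-valued trigonometric polynomial through an
auxiliary Hilbert space. -/
theorem exists_norm_sq_sum_eq {Φ : C(Circle, H →L[ℂ] H)} (hΦ : ∀ z, (Φ z).IsPositive) {d : ℕ}
    (hn : ∀ a b : H, pairing Φ (.const _ a) (.const _ b) ∈ trigPoly (d + 1)) :
    ∃ (E : Type u) (_ : NormedAddCommGroup E) (_ : InnerProductSpace ℂ E) (w : ℕ → H →L[ℂ] E),
      ∀ (z : Circle) (h : H), ‖∑ j ∈ Finset.range (d + 1), (z : ℂ) ^ j • w j h‖ ^ 2 =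
        (inner ℂ h (Φ z h)).re := by
  obtain ⟨E, _, _, _, ι, hι⟩ := (pairingCore Φ hΦ).exists_hilbert
  change ∀ x y, inner ℂ (ι x) (ι y) = fourierCoefficient (pairing Φ x y) 0 at hι
  have hmono : ∀ i j a b, inner ℂ (ι (monomial i a)) (ι (monomial j b)) =
      fourierCoefficient (pairing Φ (.const _ a) (.const _ b)) (j - i) := fun i j a b => by
    rw [hι, fourierCoefficient_pairing_monomial]
  have hshift : ∀ x, ‖ι (shift x)‖ = ‖ι x‖ := fun x => by
    rw [@norm_eq_sqrt_re_inner ℂ, @norm_eq_sqrt_re_inner ℂ E, hι, hι, pairing_shift]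
  have hbound : ∀ (j : ℕ) (h : H), ‖ι (monomial j h)‖ ≤ √‖Φ‖ * ‖h‖ := fun j h => by
    refine le_of_sq_le_sq ?_ (by positivity)
    rw [mul_pow, Real.sq_sqrt (norm_nonneg Φ), ← @inner_self_eq_norm_sq ℂ, hmono]
    refine (RCLike.re_le_norm _).trans ((norm_fourierCoefficient_le _ _).trans ?_)
    refine (ContinuousMap.norm_le _ (by positivity)).2 fun z => ?_
    calc ‖inner ℂ h (Φ z h)‖ ≤ ‖h‖ * (‖Φ z‖ * ‖h‖) :=
          (norm_inner_le_norm _ _).trans (by gcongr; exact (Φ z).le_opNorm h)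
      _ ≤ ‖h‖ * (‖Φ‖ * ‖h‖) := by gcongr; exact Φ.norm_coe_le_norm z
      _ = ‖Φ‖ * ‖h‖ ^ 2 := by ring
  let S : ℕ → Submodule ℂ E := fun k => ((tail H k).map ι).topologicalClosure
  let J : ℕ → H →L[ℂ] E := fun j => (ι ∘ₗ monomial j).mkContinuous _ (hbound j)
  have hJ : ∀ j h, J j h = ι (monomial j h) := fun _ _ => rfl
  refine ⟨E, inferInstance, inferInstance,
    fun j => ((S d).starProjection - (S (d + 1)).starProjection) ∘L J j, fun z h => ?_⟩
  -- Here `z` is a frozen scalar, not the variable of the function `x`.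
  let x : C(Circle, H) := ∑ j ∈ Finset.range d, (z : ℂ) ^ j • monomial j h
  have hx : ι x = ∑ j ∈ Finset.range d, (z : ℂ) ^ j • J j h := by simp [x, hJ]
  let v : E := ∑ j ∈ Finset.range (d + 1), (z : ℂ) ^ j • J j h
  have hv1 : v = ι x + (z : ℂ) ^ d • J d h := by rw [hx]; exact Finset.sum_range_succ _ _
  have hv2 : v = J 0 h + (z : ℂ) • ι (shift x) := by
    simp only [v, x, Finset.sum_range_succ', map_sum, map_smul, shift_monomial, hJ,
      Finset.smul_sum, smul_smul, pow_succ', pow_zero, one_smul]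
    rw [add_comm]
  have hvw : ∑ j ∈ Finset.range (d + 1), (z : ℂ) ^ j •
      (((S d).starProjection - (S (d + 1)).starProjection) ∘L J j) h =
        (S d).starProjection v - (S (d + 1)).starProjection v := by
    simp [v, smul_sub, Finset.sum_sub_distrib]
  have hSS : S (d + 1) ≤ S d :=
    Submodule.topologicalClosure_mono (Submodule.map_mono (tail_succ_le d))
  rw [hvw, norm_sq_starProjection_sub_starProjection hSS]
  -- The top term of `v` lies in `S d`, so it does not affect the distance to `S d`.
  have hD1 : v - (S d).starProjection v = ι x - (S d).starProjection (ι x) := by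
    have : (S d).starProjection (J d h) = J d h :=
      Submodule.starProjection_eq_self_iff.2 <| Submodule.le_topologicalClosure _ <|
        Submodule.mem_map_of_mem <| Submodule.subset_span ⟨d, le_rfl, h, rfl⟩
    rw [hv1, map_add, map_smul, this]
    abel
  have horth : ∀ s ∈ S (d + 1), inner ℂ (J 0 h) s = 0 := fun s hs => by
    have : S (d + 1) ≤ (Submodule.span ℂ {J 0 h})ᗮ := by
      refine Submodule.topologicalClosure_minimal _ ?_ (Submodule.isClosed_orthogonal _)
      rintro _ ⟨y, hy, rfl⟩
      rw [Submodule.mem_orthogonal_singleton_iff_inner_right, hJ, hι]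
      exact fourierCoefficient_pairing_monomial_tail hn h hy
    exact Submodule.mem_orthogonal_singleton_iff_inner_right.1 (this hs)
  have hD2 : v - (S (d + 1)).starProjection v =
      J 0 h + (z : ℂ) • (ι (shift x) - (S (d + 1)).starProjection (ι (shift x))) := by
    have : (S (d + 1)).starProjection (J 0 h) = 0 :=
      (Submodule.starProjection_apply_eq_zero_iff _).2 <| (Submodule.mem_orthogonal' _ _).2 horth
    rw [hv2, map_add, map_smul, this, smul_sub]
    abel
  -- The shift is isometric and carries `tail H d` onto `tail H (d + 1)`. This cancels the two
  -- distances, leaving `‖J 0 h‖²` and the cross term.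
  have hdist : ‖ι (shift x) - (S (d + 1)).starProjection (ι (shift x))‖ =
      ‖ι x - (S d).starProjection (ι x)‖ := by
    rw [norm_sub_starProjection_closure_eq_infDist, norm_sub_starProjection_closure_eq_infDist,
      tail_succ_eq_map, ← Submodule.map_comp, Submodule.map_coe, Submodule.map_coe]
    refine Metric.infDist_image_of_dist_eq (f := ι) (g := ι ∘ₗ shift) (fun a b => ?_) x _
    rw [dist_eq_norm, dist_eq_norm, ← map_sub, ← map_sub, LinearMap.comp_apply, hshift]
  have hcross : inner ℂ (J 0 h)
      ((z : ℂ) • (ι (shift x) - (S (d + 1)).starProjection (ι (shift x)))) =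
      ∑ j ∈ Finset.range d, fourierCoefficient (pairing Φ (.const _ h) (.const _ h)) (j + 1) *
        (z : ℂ) ^ (j + 1) := by
    rw [inner_smul_right, inner_sub_right,
      horth _ ((S (d + 1)).starProjection_apply_mem _), sub_zero]
    simp only [x, map_sum, map_smul, shift_monomial, inner_sum, inner_smul_right, hJ, hmono,
      Finset.mul_sum]
    refine Finset.sum_congr rfl fun j _ => ?_
    push_cast
    rw [sub_zero]
    ring
  rw [hD1, hD2, @norm_add_sq ℂ, norm_smul, Circle.norm_coe, one_mul, hdist, hcross,
    re_inner_apply_eq_fourier_sum hΦ h (hn h h) z, ← @inner_self_eq_norm_sq ℂ E _ _ _ (J 0 h), hJ,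
    hmono, sub_self]
  simp only [RCLike.re_to_complex]
  ring

end TrigSystem

/-! ### Scalar minorants and their Toeplitz form. -/

namespace TrigSystem

variable {H : Type*} [NormedAddCommGroup H] [InnerProductSpace ℂ H]

/-- A nonzero element of the cone dominates a nonzero function `z ↦ w* T_n(z⁻¹) w`. -/
theorem exists_norm_sq_sum_le {n : ℕ} {F : trigPoly n ⊗[ℂ] (H →L[ℂ] H)}
    (hF : F ∈ positiveCone H n) (hF0 : functionForm H n F ≠ 0) :
    ∃ w : Fin n → H →L[ℂ] ℂ,
      (∀ (z : Circle) (h : H), ‖∑ j : Fin n, (z : ℂ) ^ (j : ℕ) * w j h‖ ^ 2 ≤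
        (inner ℂ h (functionForm H n F z h)).re) ∧
      ∃ (z : Circle) (h : H), ∑ j : Fin n, (z : ℂ) ^ (j : ℕ) * w j h ≠ 0 := by
  have htrig : ∀ a b : H, pairing (functionForm H n F) (.const _ a) (.const _ b) ∈ trigPoly n :=
    inner_functionForm_mem_trigPoly n F
  obtain _ | d := n
  -- For `n = 0` the Fourier sum is empty, so the function form vanishes.
  · refine absurd ?_ hF0
    ext z b
    refine ext_inner_left ℂ fun a => ?_
    have := trigPoly_apply_eq_sum (htrig a b) z
    simpa using this
  obtain ⟨E, _, _, v, hv⟩ := exists_norm_sq_sum_eq hF htrig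
  obtain ⟨z₀, h₀, hne⟩ : ∃ (z : Circle) (h : H),
      ∑ j ∈ Finset.range (d + 1), (z : ℂ) ^ j • v j h ≠ 0 := by
    by_contra! hall
    refine hF0 (ContinuousMap.ext fun z => ?_)
    have hpos := hF z
    have h0 : ∀ h, inner ℂ h (functionForm H (d + 1) F z h) = 0 := fun h => by
      have hre := hv z h
      rw [hall, norm_zero, zero_pow two_ne_zero] at hre
      have := hpos.inner_nonneg_right h
      rw [Complex.nonneg_iff] at this
      exact Complex.ext hre.symm this.2.symm
    refine ContinuousLinearMap.coe_injective ((ext_inner_map _ _).1 fun h => ?_)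
    rw [← inner_conj_symm, ContinuousLinearMap.coe_coe, h0]
    simp
  -- Normalizing a nonzero value of the factor gives a direction in which the compressed factor is
  -- still nonzero.
  let e : E := ∑ j ∈ Finset.range (d + 1), (z₀ : ℂ) ^ j • v j h₀
  let u : E := ((‖e‖⁻¹ : ℝ) : ℂ) • e
  have he : ‖e‖ ≠ 0 := norm_ne_zero_iff.2 hne
  have hu : ‖u‖ = 1 := by
    rw [norm_smul, Complex.norm_real, norm_inv, norm_norm, inv_mul_cancel₀ he]
  have hsum : ∀ (z : ℂ) (h : H), ∑ j : Fin (d + 1), z ^ (j : ℕ) * (innerSL ℂ u ∘L v j) h =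
      inner ℂ u (∑ j ∈ Finset.range (d + 1), z ^ j • v j h) := fun z h => by
    rw [inner_sum, Finset.sum_range]
    simp [inner_smul_right]
  refine ⟨fun j => innerSL ℂ u ∘L v j, fun z h => ?_, z₀, h₀, ?_⟩
  · rw [hsum, ← hv z h]
    gcongr
    exact (norm_inner_le_norm _ _).trans_eq (by rw [hu, one_mul])
  · rw [hsum, inner_smul_left, inner_self_eq_norm_sq_to_K]
    simp [he]

/-- The operator `H → ℂⁿ` with given coordinate functionals. -/
noncomputable def euclideanPi {n : ℕ} (w : Fin n → H →L[ℂ] ℂ) : H →L[ℂ] EuclideanSpace ℂ (Fin n) :=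
  (EuclideanSpace.equiv (Fin n) ℂ).symm.toContinuousLinearMap ∘L ContinuousLinearMap.pi w

set_option synthInstance.maxHeartbeats 200000 in
theorem functionForm_sub_apply (n : ℕ) (F G : trigPoly n ⊗[ℂ] (H →L[ℂ] H)) (z : Circle) :
    functionForm H n (F - G) z = functionForm H n F z - functionForm H n G z := by
  rw [map_sub, ContinuousMap.sub_apply]

variable [CompleteSpace H]

theorem inner_adjoint_comp_universalToeplitz_comp {n : ℕ} (w : Fin n → H →L[ℂ] ℂ) (z : Circle)
    (a b : H) :
    inner ℂ a ((ContinuousLinearMap.adjoint (euclideanPi w) ∘L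
      Matrix.toEuclideanCLM (𝕜 := ℂ) (universalToeplitz n z⁻¹) ∘L euclideanPi w) b) =
      ∑ i : Fin n, ∑ j : Fin n, (z : ℂ) ^ ((j : ℤ) - (i : ℤ)) * inner ℂ (w i a) (w j b) := by
  rw [ContinuousLinearMap.comp_apply, ContinuousLinearMap.adjoint_inner_right, PiLp.inner_apply]
  refine Finset.sum_congr rfl fun i _ => ?_
  rw [ContinuousLinearMap.comp_apply, Matrix.ofLp_toEuclideanCLM, Matrix.mulVec, dotProduct,
    inner_sum]
  refine Finset.sum_congr rfl fun j _ => ?_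
  rw [universalToeplitz, Matrix.of_apply, ← smul_eq_mul, inner_smul_right, Circle.coe_inv,
    inv_zpow', neg_sub]
  rfl

/-- `T_n(z⁻¹)` has rank one: its entry `z^(j-i)` is `conj (z^i) * z^j`, so the quadratic form is a
perfect square. -/
theorem inner_self_adjoint_comp_universalToeplitz_comp {n : ℕ} (w : Fin n → H →L[ℂ] ℂ) (z : Circle)
    (h : H) :
    inner ℂ h ((ContinuousLinearMap.adjoint (euclideanPi w) ∘L
      Matrix.toEuclideanCLM (𝕜 := ℂ) (universalToeplitz n z⁻¹) ∘L euclideanPi w) h) =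
      ((‖∑ j : Fin n, (z : ℂ) ^ (j : ℕ) * w j h‖ ^ 2 : ℝ) : ℂ) := by
  rw [inner_adjoint_comp_universalToeplitz_comp]
  push_cast
  rw [← Complex.conj_mul', map_sum, Finset.sum_mul_sum]
  refine Finset.sum_congr rfl fun i _ => Finset.sum_congr rfl fun j _ => ?_
  rw [zpow_sub₀ (Circle.coe_ne_zero z), map_mul, map_pow, ← Circle.coe_inv_eq_conj, Circle.coe_inv,
    zpow_natCast, zpow_natCast, RCLike.inner_apply, inv_pow]
  ring

/-- Every function `z ↦ w* T_n(z⁻¹) w` comes from the tensor product. -/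
theorem exists_functionForm_eq {n : ℕ} (w : Fin n → H →L[ℂ] ℂ) :
    ∃ G : trigPoly n ⊗[ℂ] (H →L[ℂ] H), ∀ z, functionForm H n G z =
      ContinuousLinearMap.adjoint (euclideanPi w) ∘L
        Matrix.toEuclideanCLM (𝕜 := ℂ) (universalToeplitz n z⁻¹) ∘L euclideanPi w := by
  have hc : ∀ i j : Fin n, character ((j : ℤ) - (i : ℤ)) ∈ trigPoly n := fun i j =>
    character_mem_trigPoly (by rw [abs_lt]; omega)
  -- Entry `(i, j)` of the Toeplitz matrix contributes `z^(j-i) ⊗ w_i* w_j`, and `|j - i| < n`.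
  refine ⟨∑ i, ∑ j, (⟨_, hc i j⟩ : trigPoly n) ⊗ₜ (ContinuousLinearMap.adjoint (w i) ∘L w j),
    fun z => ContinuousLinearMap.ext fun b => ext_inner_left ℂ fun a => ?_⟩
  rw [inner_adjoint_comp_universalToeplitz_comp]
  simp only [map_sum, ContinuousMap.sum_apply, functionForm_tmul_apply,
    sum_apply, smul_apply, ContinuousLinearMap.comp_apply,
    inner_sum, inner_smul_right, ContinuousLinearMap.adjoint_inner_right, character_apply]

theorem isPositive_adjoint_comp_universalToeplitz_comp {n : ℕ} (w : Fin n → H →L[ℂ] ℂ)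
    (z : Circle) :
    (ContinuousLinearMap.adjoint (euclideanPi w) ∘L
      Matrix.toEuclideanCLM (𝕜 := ℂ) (universalToeplitz n z⁻¹) ∘L euclideanPi w).IsPositive := by
  rw [ContinuousLinearMap.isPositive_iff_complex]
  intro h
  rw [← inner_conj_symm, inner_self_adjoint_comp_universalToeplitz_comp, Complex.conj_ofReal]
  rw [RCLike.re_to_complex, Complex.ofReal_re]
  exact ⟨rfl, by positivity⟩

end TrigSystem

/-! ### Conclusion from purity. -/

theorem mainTheorem6 {H : Type*} [NormedAddCommGroup H] [InnerProductSpace ℂ H]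
    [CompleteSpace H] (n : ℕ) (F : TrigSystem.trigPoly n ⊗[ℂ] (H →L[ℂ] H))
    (hF : TrigSystem.IsPure (TrigSystem.positiveCone H n) F) :
    ∃ w : H →L[ℂ] EuclideanSpace ℂ (Fin n), ∀ z : Circle,
      TrigSystem.functionForm H n F z =
        (ContinuousLinearMap.adjoint w) ∘L
          (Matrix.toEuclideanCLM (𝕜 := ℂ) (TrigSystem.universalToeplitz n z⁻¹)) ∘L w := by
  -- Purity as defined admits `F = 0`, for which `w = 0` works.
  by_cases hF0 : TrigSystem.functionForm H n F = 0
  · exact ⟨0, fun z => by rw [hF0]; simp⟩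
  obtain ⟨hmem, hpure⟩ := hF
  obtain ⟨w, hle, z₀, h₀, hne⟩ := TrigSystem.exists_norm_sq_sum_le hmem hF0
  obtain ⟨G, hG⟩ := TrigSystem.exists_functionForm_eq w
  have hGmem : G ∈ TrigSystem.positiveCone H n := fun z => by
    rw [hG]
    exact TrigSystem.isPositive_adjoint_comp_universalToeplitz_comp w z
  have hsub : F - G ∈ TrigSystem.positiveCone H n := fun z => by
    have h1 := hmem z
    have h2 := hGmem z
    rw [TrigSystem.functionForm_sub_apply]
    refine (ContinuousLinearMap.isPositive_def' ..).2
      ⟨h1.isSelfAdjoint.sub h2.isSelfAdjoint, fun h => ?_⟩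
    rw [ContinuousLinearMap.reApplyInnerSelf_apply, inner_re_symm, sub_apply,
      inner_sub_right, hG, TrigSystem.inner_self_adjoint_comp_universalToeplitz_comp]
    rw [RCLike.re_to_complex, Complex.sub_re, Complex.ofReal_re, sub_nonneg]
    exact hle z h
  obtain ⟨s, ⟨hs, -⟩, hGs, -⟩ := hpure G hGmem (F - G) hsub (add_sub_cancel G F)
  have hform : ∀ z, TrigSystem.functionForm H n G z =
      (s : ℂ) • TrigSystem.functionForm H n F z := fun z => by
    rw [hGs, show s • F = (s : ℂ) • F from (algebraMap_smul ℂ s F).symm, map_smul]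
    rfl
  have hs0 : s ≠ 0 := by
    rintro rfl
    have h1 := TrigSystem.inner_self_adjoint_comp_universalToeplitz_comp w z₀ h₀
    rw [← hG, hform] at h1
    rw [Complex.ofReal_zero, zero_smul, zero_apply, inner_zero_right, eq_comm,
      Complex.ofReal_eq_zero, sq_eq_zero_iff, norm_eq_zero] at h1
    exact hne h1
  -- Since `w` enters once linearly and once through its adjoint, the factor `1/s` is split as
  -- `(√s)⁻¹ (√s)⁻¹`.
  refine ⟨((√s)⁻¹ : ℂ) • TrigSystem.euclideanPi w, fun z => ?_⟩
  have hsq : ((√s : ℝ) : ℂ) * ((√s : ℝ) : ℂ) = s := by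
    rw [← Complex.ofReal_mul, Real.mul_self_sqrt hs]
  have hss : ((√s : ℝ) : ℂ)⁻¹ * ((√s : ℝ) : ℂ)⁻¹ * s = 1 := by
    rw [← mul_inv, hsq, inv_mul_cancel₀ (by exact_mod_cast hs0)]
  rw [map_smulₛₗ, map_inv₀, Complex.conj_ofReal, ContinuousLinearMap.comp_smul,
    ContinuousLinearMap.comp_smul, ContinuousLinearMap.smul_comp, smul_smul, ← hG, hform, smul_smul,
    hss, one_smul]
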